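/- Let $K$ be a finite field, $s\ge 2$, and let $A_1,\dots,A_s\subseteq K$ satisfy: (i) $\{0,1\}\subseteq A_i$ for all $i$; (ii) $a/b\in A_j$ whenever $1\le i<j\le s$, $a\in A_j$ and $0\ne b\in A_i$; (iii) $d_1\le\cdots\le d_s$, where $d_i=|A_i|$. Let $\mathcal X=[A_1\times\cdots\times A_s]\subseteq\mathbb P_K^{s-1}$ be the image of $(A_1\times\cdots\times A_s)\setminus\{0\}$ under $x\mapsto[x]$. Let $S=K[t_1,\dots,t_s]$ with the standard grading $S=\bigoplus_{d\ge0}S_d$, let $I(\mathcal X)\subseteq S$ be the ideal generated by the homogeneous polynomials that vanish at all points of $\mathcal X$, and let $\deg(S/I(\mathcal X))$ be its degree (multiplicity): for a graded ideal $I$ with $k'=\dim S/I$ (Krull dimension), $\deg(S/I)=(k'-1)!\lim_{n\to\infty}\dim_K(S_n/I_n)/n^{k'-1}$ if $k'\ge1$, and $\deg(S/I)=\dim_K(S/I)$ if $k'=0$. Let $\prec$ be the lexicographical order on the monomials of $S$ with $t_1\prec\cdots\prec t_s$, and write ${\rm in}_\prec(f)$ for the largest monomial occurring in $f\neq0$.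 A polynomial $f\ne0$ is called standard if none of the monomials occurring in $f$ is the leading monomial of a nonzero element of $I(\mathcal X)$. Let $V_{\mathcal X}(f)$ be the set of zeros in $\mathcal X$ of a homogeneous polynomial $f$. **Theorem.** Let $d$ be an integer with $1\le d\le\sum_{i=2}^s(d_i-1)$, and let $0\ne f\in S_d$ be a standard polynomial such that $t_1$ divides ${\rm in}_\prec(f)$. Then there are unique integers $k,\ell$ with $0\le k\le s-2$, $1\le\ell\le d_{k+2}-1$ and $d=\sum_{i=2}^{k+1}(d_i-1)+\ell$, and for these $$|V_{\mathcal X}(f)|\le\deg(S/I(\mathcal X))-(d_{k+2}-\ell+1)\,d_{k+3}\cdots d_s,$$ where an empty product is $1$. -/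

import Mathlib

open MvPolynomial Filter Topology

namespace NestedCartesian

/-! ### Hilbert function and degree of a graded quotient of a polynomial ring -/

/-- The Hilbert function `H_I(n) = dim_K (S_n / I_n)`, where `I_n = I ∩ S_n`. -/
noncomputable def hilbertFunction {K : Type*} [Field K] {s : ℕ}
    (I : Ideal (MvPolynomial (Fin s) K)) (n : ℕ) : ℕ :=
  Module.finrank K
    (homogeneousSubmodule (Fin s) K n ⧸
      (I.restrictScalars K).submoduleOf (homogeneousSubmodule (Fin s) K n))

/-- The Krull dimension of `S / I` as a natural number (`0` for the zero ring; it is never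
infinite, as `S` has finitely many variables). -/
noncomputable def quotientDim {K : Type*} [Field K] {s : ℕ}
    (I : Ideal (MvPolynomial (Fin s) K)) : ℕ :=
  ((ringKrullDim (MvPolynomial (Fin s) K ⧸ I)).unbotD 0).toNat

/-- The degree (multiplicity) of `S / I` for a graded ideal `I`: with `k = dim S / I`, it is
`(k - 1)! * lim_{n → ∞} H_I(n) / n ^ (k - 1)` if `k ≥ 1`, and `dim_K (S / I)` if `k = 0`. -/
noncomputable def quotientDegree {K : Type*} [Field K] {s : ℕ}
    (I : Ideal (MvPolynomial (Fin s) K)) : ℝ :=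
  if quotientDim I = 0 then (Module.finrank K (MvPolynomial (Fin s) K ⧸ I) : ℝ)
  else ((quotientDim I - 1).factorial : ℝ) *
    limUnder atTop
      (fun n : ℕ => (hilbertFunction I n : ℝ) / (n : ℝ) ^ (quotientDim I - 1))

/-! ### Subsets of projective space, vanishing ideals, zero sets -/

/-- `f` vanishes at the projective point `P`, i.e. at every representative of `P`. -/
def VanishesAt {K : Type*} [Field K] {s : ℕ} (f : MvPolynomial (Fin s) K)
    (P : Projectivization K (Fin s → K)) : Prop :=
  ∀ (v : Fin s → K) (hv : v ≠ 0), Projectivization.mk K v hv = P → eval v f = 0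

/-- The ideal `I(X)` generated by the homogeneous polynomials vanishing on all of `X`. -/
noncomputable def vanishingIdeal {K : Type*} [Field K] {s : ℕ}
    (X : Set (Projectivization K (Fin s → K))) : Ideal (MvPolynomial (Fin s) K) :=
  Ideal.span {f | (∃ n : ℕ, f.IsHomogeneous n) ∧ ∀ P ∈ X, VanishesAt f P}

/-- The zero set `V_X(f)` of a homogeneous polynomial `f` in `X`. -/
def zeroSet {K : Type*} [Field K] {s : ℕ} (X : Set (Projectivization K (Fin s → K)))
    (f : MvPolynomial (Fin s) K) : Set (Projectivization K (Fin s → K)) :=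
  {P | P ∈ X ∧ VanishesAt f P}

/-! ### Projective nested cartesian sets -/

/-- `[A_1 × ⋯ × A_s]`, the image of `(A_1 × ⋯ × A_s) \ {0}` in projective space. The set `A_j` of
the text is `A` at the index `j - 1`. -/
def cartesianSet {K : Type*} [Field K] {s : ℕ} (A : Fin s → Finset K) :
    Set (Projectivization K (Fin s → K)) :=
  {P | ∃ (v : Fin s → K) (hv : v ≠ 0), (∀ i, v i ∈ A i) ∧ Projectivization.mk K v hv = P}

/-- The conditions on `A_1, …, A_s` under which `[A_1 × ⋯ × A_s]` is a projective nested
cartesian set. -/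
structure IsNested {K : Type*} [Field K] {s : ℕ} (A : Fin s → Finset K) : Prop where
  zero_mem : ∀ i, (0 : K) ∈ A i
  one_mem : ∀ i, (1 : K) ∈ A i
  div_mem : ∀ i j, i < j → ∀ a ∈ A j, ∀ b ∈ A i, b ≠ 0 → a / b ∈ A j
  card_mono : ∀ i j, i ≤ j → (A i).card ≤ (A j).card

/-- `d_j = |A_j|` for `1 ≤ j ≤ s`, with indices counted from `1`; only such `j` are used. -/
def setSize {K : Type*} {s : ℕ} (A : Fin s → Finset K) (j : ℕ) : ℕ :=
  if h : j - 1 < s then (A ⟨j - 1, h⟩).card else 0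

/-- `0 ≤ k ≤ s - 2`, `d = ∑_{i=2}^{k+1} (d_i - 1) + ℓ` and `1 ≤ ℓ ≤ d_{k+2} - 1`. -/
def IsDegreeDecomposition {K : Type*} {s : ℕ} (A : Fin s → Finset K) (d k ℓ : ℕ) : Prop :=
  k + 2 ≤ s ∧ d = ∑ i ∈ Finset.Icc 2 (k + 1), (setSize A i - 1) + ℓ ∧
    1 ≤ ℓ ∧ ℓ ≤ setSize A (k + 2) - 1

/-! ### Standard polynomials -/

/-- The lexicographical order with `t_1 ≺ ⋯ ≺ t_s`. (The lexicographical order on a linearly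
ordered set of variables makes smaller indices larger variables, so the indices are reversed.) -/
noncomputable def lexOrder (s : ℕ) : MonomialOrder (Fin s) :=
  (MonomialOrder.lex : MonomialOrder (Fin s)ᵒᵈ)

/-- `t^a ≺ t^b` iff `a_j < b_j` at the largest index `j` where the two exponents differ. -/
theorem lexOrder_lt_iff {s : ℕ} (a b : Fin s →₀ ℕ) :
    (lexOrder s).toSyn a < (lexOrder s).toSyn b ↔
      ∃ j : Fin s, (∀ i, j < i → a i = b i) ∧ a j < b j :=
  Iff.rfl

/-- `t^a` is a standard monomial of `S / I`: it is not the leading monomial of any nonzero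
polynomial in `I`. -/
def IsStandardMonomial {K : Type*} [Field K] {s : ℕ} (m : MonomialOrder (Fin s))
    (I : Ideal (MvPolynomial (Fin s) K)) (a : Fin s →₀ ℕ) : Prop :=
  ∀ g ∈ I, g ≠ 0 → m.degree g ≠ a

/-- A standard polynomial: nonzero and a `K`-linear combination of standard monomials. -/
def IsStandardPolynomial {K : Type*} [Field K] {s : ℕ} (m : MonomialOrder (Fin s))
    (I : Ideal (MvPolynomial (Fin s) K)) (f : MvPolynomial (Fin s) K) : Prop :=
  f ≠ 0 ∧ ∀ a ∈ f.support, IsStandardMonomial m I a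

/-- The initial monomial `in(f)` of a nonzero polynomial `f`. -/
noncomputable def initialMonomial {K : Type*} [Field K] {s : ℕ} (m : MonomialOrder (Fin s))
    (f : MvPolynomial (Fin s) K) : MvPolynomial (Fin s) K :=
  monomial (m.degree f) 1

end NestedCartesian

namespace NestedCartesian

/-! Let `t^a` be the leading monomial of `f`. For `j ≥ 2` the form `t_1 ∏_{c ∈ A_j} (t_j - c t_1)`
lies in the vanishing ideal and has leading monomial `t_1 t_j^{d_j}`. Since `t_1` divides `t^a` and
`f` is standard, `a_j < d_j`, and `∑_{j ≥ 2} a_j = d - a_1 < d` (`IsStandardMonomial.lt_card`). On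
the chart `t_1 = 1` the set is the grid `A_2 × ⋯ × A_s`, where `f` has at least `∏_{j ≥ 2} (d_j -
a_j)` nonzeros (`lex_footprint`, `prod_le_ncard_diff_zeroSet`). Under the constraints on `a`, this
product is smallest when the degree `d - 1` is spent on the small `d_j` first (`prod_one_add_ge`,
`le_prod_card_sub`), which gives the subtracted term. Finally, the degree of the coordinate ring is
the number of points (`quotientDegree_vanishingIdeal`), so a lower bound on nonzeros is an upper
bound on zeros. -/

/-! ### Minimising a product under a sum constraint -/

/-- The right side minus the left is `t (q + t - p)`, and either alternative in `h` gives `p ≤ q +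
t`. -/
theorem push_mul_le {p q t D : ℕ} (htp : t ≤ p) (hp : p ≤ D) (hq : q + t ≤ D)
    (h : t = p ∨ q + t = D) :
    (1 + (p - t)) * (1 + (q + t)) ≤ (1 + p) * (1 + q) := by
  obtain ⟨r, rfl⟩ := Nat.exists_eq_add_of_le htp
  rw [Nat.add_sub_cancel_left]
  rcases h with h | h
  · have : r = 0 := by omega
    subst this
    nlinarith [Nat.zero_le (t * q)]
  · obtain ⟨w, rfl⟩ : ∃ w, q = r + w := ⟨q - r, by omega⟩
    nlinarith [Nat.zero_le (t * w)]

/-- Among bounded tuples with a prescribed lower bound on the sum of the entries, the product of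
the `1 + x i` is smallest when the large indices are filled first. -/
theorem prod_one_add_ge (E : ℕ → ℕ) (m : ℕ) (hE : ∀ i j, i ≤ j → j < m → E i ≤ E j)
    (k y : ℕ) (hk : k < m) (hy : y ≤ E k) (x : ℕ → ℕ) (hx : ∀ i < m, x i ≤ E i)
    (hsum : y + ∑ i ∈ Finset.Ico (k + 1) m, E i ≤ ∑ i ∈ Finset.range m, x i) :
    (1 + y) * ∏ i ∈ Finset.Ico (k + 1) m, (1 + E i) ≤ ∏ i ∈ Finset.range m, (1 + x i) := by
  induction m generalizing x with
  | zero => omega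
  | succ m ih =>
    -- Inner induction on the unused room in the last coordinate; each transfer into that coordinate
    -- shrinks it.
    obtain ⟨u, hu⟩ : ∃ u, u = E m - x m := ⟨_, rfl⟩
    induction u using Nat.strong_induction_on generalizing x with
    | _ u ihu =>
    have hxm := hx m (by omega)
    have hone : 1 ≤ ∏ i ∈ Finset.range m, (1 + x i) :=
      Nat.one_le_iff_ne_zero.2 (Finset.prod_ne_zero_iff.2 fun i _ => by omega)
    by_cases hfull : x m = E m
    · rw [Finset.prod_range_succ]
      rcases Nat.lt_succ_iff_lt_or_eq.1 hk with hkm | rfl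
      · rw [Finset.prod_Ico_succ_top (by omega), ← mul_assoc, hfull]
        rw [Finset.sum_Ico_succ_top (by omega), Finset.sum_range_succ] at hsum
        exact Nat.mul_le_mul_right _ (ih (fun i j hij hj => hE i j hij (by omega)) hkm x
          (fun i hi => hx i (by omega)) (by omega))
      · simp only [Finset.Ico_self, Finset.prod_empty, mul_one]
        nlinarith
    by_cases hz : ∀ i < m, x i = 0
    · have h0 : ∑ i ∈ Finset.range m, x i = 0 :=
        Finset.sum_eq_zero fun i hi => hz i (Finset.mem_range.1 hi)
      rw [Finset.sum_range_succ, h0] at hsum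
      rcases Nat.lt_succ_iff_lt_or_eq.1 hk with hkm | rfl
      · rw [Finset.sum_Ico_succ_top (by omega)] at hsum
        omega
      · simp only [Finset.Ico_self, Finset.sum_empty] at hsum
        rw [Finset.prod_range_succ]
        simp only [Finset.Ico_self, Finset.prod_empty, mul_one]
        nlinarith
    push Not at hz
    obtain ⟨i, him, hi0⟩ := hz
    have hiE := hx i (by omega)
    have hEi := hE i m (by omega) (by omega)
    -- The largest possible transfer from `i` to `m`: it empties `i` or fills `m`, as `push_mul_le`
    -- requires.
    obtain ⟨t, ht⟩ : ∃ t, t = min (x i) (E m - x m) := ⟨_, rfl⟩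
    set x' := Function.update (Function.update x i (x i - t)) m (x m + t) with hx'
    have hm' : x' m = x m + t := by simp [hx']
    have hi' : x' i = x i - t := by simp [hx', him.ne]
    have ho' : ∀ j, j ≠ i → j ≠ m → x' j = x j := fun j h1 h2 => by simp [hx', h1, h2]
    have hmem : i ∈ Finset.range m := Finset.mem_range.2 him
    have herase : ∀ j ∈ (Finset.range m).erase i, x' j = x j := fun j hj => by
      rw [Finset.mem_erase, Finset.mem_range] at hj
      exact ho' j hj.1 (by omega)
    refine (ihu (E m - x' m) (by omega) x' (fun j hj => ?_) ?_ rfl).trans ?_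
    · by_cases h1 : j = i
      · subst h1; omega
      by_cases h2 : j = m
      · subst h2; omega
      rw [ho' j h1 h2]; exact hx j hj
    · refine hsum.trans (le_of_eq ?_)
      have e₁ : x i + ∑ j ∈ (Finset.range m).erase i, x j = ∑ j ∈ Finset.range m, x j :=
        Finset.add_sum_erase _ _ hmem
      have e₂ : x' i + ∑ j ∈ (Finset.range m).erase i, x' j = ∑ j ∈ Finset.range m, x' j :=
        Finset.add_sum_erase _ _ hmem
      have e₃ : ∑ j ∈ (Finset.range m).erase i, x' j = ∑ j ∈ (Finset.range m).erase i, x j :=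
        Finset.sum_congr rfl herase
      rw [Finset.sum_range_succ, Finset.sum_range_succ]
      omega
    · rw [Finset.prod_range_succ, Finset.prod_range_succ, ← Finset.mul_prod_erase _ _ hmem,
        ← Finset.mul_prod_erase _ (fun j => 1 + x j) hmem,
        Finset.prod_congr rfl fun j hj => by rw [herase j hj], hi', hm', mul_right_comm,
        mul_right_comm (1 + x i)]
      exact Nat.mul_le_mul_right _ (push_mul_le (D := E m) (by omega) (by omega) (by omega)
        (by omega))

/-! ### Nonzeros on an affine grid -/

/-- The footprint bound for the lexicographical order in which the last variable is the largest:
a linear combination of monomials with a largest term `∏ i, v i ^ e t₀ i` has at least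
`∏ i, (#(B i) - e t₀ i)` nonzeros on the grid `∏ i, B i`. -/
theorem lex_footprint {K ι : Type*} [Field K] [DecidableEq K] (n : ℕ) (B : Fin n → Finset K)
    (T : Finset ι) (c : ι → K) (e : ι → Fin n → ℕ) (t₀ : ι) (ht₀ : t₀ ∈ T) (hc : c t₀ ≠ 0)
    (hlt : ∀ t ∈ T, t ≠ t₀ → ∃ j, (∀ i, j < i → e t i = e t₀ i) ∧ e t j < e t₀ j) :
    ∏ i, ((B i).card - e t₀ i) ≤
      ((Fintype.piFinset B).filter fun v => ∑ t ∈ T, c t * ∏ i, v i ^ e t i ≠ 0).card := by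
  classical
  induction n generalizing T with
  | zero =>
    have hT : T = {t₀} := Finset.eq_singleton_iff_unique_mem.2
      ⟨ht₀, fun t ht => by_contra fun h => (hlt t ht h).choose.elim0⟩
    subst hT
    simp [hc]
  | succ n ih =>
    set a := e t₀ (Fin.last n) with ha
    have hle : ∀ t ∈ T, e t (Fin.last n) ≤ a := fun t ht => by
      by_cases h : t = t₀
      · rw [h]
      obtain ⟨j, hj, hj'⟩ := hlt t ht h
      rcases (Fin.le_last j).lt_or_eq with h' | rfl
      · exact (hj _ h').le
      · exact hj'.le
    set T' := T.filter fun t => e t (Fin.last n) = a with hT'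
    have key := ih (fun i => B i.castSucc) T' (fun t i => e t i.castSucc) (by simp [hT', ht₀, ha])
      (fun t ht hne => by
        rw [hT', Finset.mem_filter] at ht
        obtain ⟨j, hj, hj'⟩ := hlt t ht.1 hne
        induction j using Fin.lastCases with
        | last => omega
        | cast j => exact ⟨j, fun i hi => hj _ (by simpa using hi), hj'⟩)
    set G := (Fintype.piFinset fun i : Fin n => B i.castSucc).filter
      fun v => ∑ t ∈ T', c t * ∏ i, v i ^ e t i.castSucc ≠ 0 with hG
    have hfib : ∀ w ∈ G, (B (Fin.last n)).card - a ≤ ((B (Fin.last n)).filter fun x =>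
        ∑ t ∈ T, c t * ∏ i, (Fin.snoc w x : Fin (n + 1) → K) i ^ e t i ≠ 0).card := by
      intro w hw
      rw [hG, Finset.mem_filter] at hw
      -- With `w` fixed, the sum is a polynomial in the last variable. Its coefficient at `a` is the
      -- sum over `T'`, nonzero for `w ∈ G`, so it has at most `a` roots.
      set p : Polynomial K := ∑ t ∈ T,
        Polynomial.monomial (e t (Fin.last n)) (c t * ∏ i, w i ^ e t i.castSucc) with hp
      have hev : ∀ x, ∑ t ∈ T, c t * ∏ i, (Fin.snoc w x : Fin (n + 1) → K) i ^ e t i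
          = p.eval x := fun x => by
        rw [hp, Polynomial.eval_finsetSum]
        refine Finset.sum_congr rfl fun t _ => ?_
        rw [Fin.prod_univ_castSucc, Polynomial.eval_monomial]
        simp [mul_assoc]
      have hdeg : p.natDegree ≤ a := Polynomial.natDegree_sum_le_of_forall_le _ _ fun t ht =>
        (Polynomial.natDegree_monomial_le _).trans (hle t ht)
      have hcoeff : p.coeff a = ∑ t ∈ T', c t * ∏ i, w i ^ e t i.castSucc := by
        rw [hp, Polynomial.finsetSum_coeff, hT', Finset.sum_filter]
        exact Finset.sum_congr rfl fun t _ => Polynomial.coeff_monomial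
      have hp0 : p ≠ 0 := fun h => hw.2 (by rw [← hcoeff, h, Polynomial.coeff_zero])
      simp only [hev]
      have hsplit := Finset.card_filter_add_card_filter_not (s := B (Fin.last n))
        (fun x => p.eval x ≠ 0)
      have hroots : ((B (Fin.last n)).filter fun x => ¬ p.eval x ≠ 0).card ≤ a := by
        refine le_trans ?_ ((Multiset.toFinset_card_le p.roots).trans
          ((Polynomial.card_roots' p).trans hdeg))
        refine Finset.card_le_card fun x hx => ?_
        rw [Finset.mem_filter, not_not] at hx
        simpa [hp0] using hx.2
      omega
    rw [Fin.prod_univ_castSucc]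
    calc _ ≤ G.card * ((B (Fin.last n)).card - a) := Nat.mul_le_mul_right _ key
      _ = ∑ w ∈ G, ((B (Fin.last n)).card - a) := by rw [Finset.sum_const, smul_eq_mul]
      _ ≤ _ := Finset.sum_le_sum hfib
      _ = _ := (Finset.card_sigma _ _).symm
      _ ≤ _ := Finset.card_le_card_of_injOn (fun q => Fin.snoc q.1 q.2) ?_ ?_
    · rintro ⟨w, x⟩ hq
      simp only [Finset.coe_sigma, Set.mem_sigma_iff, Finset.mem_coe, hG, Finset.mem_filter,
        Fintype.mem_piFinset] at hq
      rw [Finset.mem_coe, Finset.mem_filter, Fintype.mem_piFinset]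
      refine ⟨fun i => ?_, hq.2.2⟩
      induction i using Fin.lastCases with
      | last => simpa using hq.2.1
      | cast i => simpa using hq.1.1 i
    · rintro ⟨w, x⟩ - ⟨w', x'⟩ - h
      obtain ⟨rfl, rfl⟩ := Fin.snoc_injective2 h
      rfl

/-! ### Restriction to lines and the vanishing ideal -/

/-- Restriction of polynomials to the line through `v`: the substitution `t_i ↦ v_i T`. -/
noncomputable def restrictToLine {K : Type*} [Field K] {s : ℕ} (v : Fin s → K) :
    MvPolynomial (Fin s) K →ₐ[K] Polynomial K :=
  aeval fun i => Polynomial.C (v i) * Polynomial.X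

theorem eval_restrictToLine {K : Type*} [Field K] {s : ℕ} (v : Fin s → K) (a : K)
    (f : MvPolynomial (Fin s) K) : (restrictToLine v f).eval a = eval (a • v) f := by
  rw [← Polynomial.coe_evalRingHom]
  have : (Polynomial.evalRingHom a).comp (restrictToLine v).toRingHom = eval (a • v) := by
    ext i
    · simp [restrictToLine]
    · simp [restrictToLine, mul_comm (v i) a]
  exact congrArg (fun φ : MvPolynomial (Fin s) K →+* K => φ f) this

theorem coeff_restrictToLine {K : Type*} [Field K] {s : ℕ} (v : Fin s → K) (n : ℕ)
    (f : MvPolynomial (Fin s) K) :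
    (restrictToLine v f).coeff n = eval v (homogeneousComponent n f) := by
  induction f using MvPolynomial.induction_on' with
  | add p q hp hq => simp [hp, hq]
  | monomial u c =>
    rw [homogeneousComponent_of_mem ((mem_homogeneousSubmodule _ _).2 (isHomogeneous_monomial c rfl)),
      restrictToLine, aeval_monomial]
    have h : (u.prod fun i e => (Polynomial.C (v i) * Polynomial.X : Polynomial K) ^ e) =
        Polynomial.C (u.prod fun i e => v i ^ e) * Polynomial.X ^ u.degree := by
      simp [Finsupp.prod, mul_pow, Finset.prod_mul_distrib, Finset.prod_pow_eq_pow_sum,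
        Finsupp.degree_apply, map_prod]
    rw [h, Polynomial.algebraMap_eq, ← mul_assoc, ← Polynomial.C_mul, Polynomial.coeff_C_mul_X_pow]
    split_ifs <;> simp [eval_monomial]

theorem restrictToLine_of_isHomogeneous {K : Type*} [Field K] {s : ℕ} (v : Fin s → K) {n : ℕ}
    {f : MvPolynomial (Fin s) K} (hf : f.IsHomogeneous n) :
    restrictToLine v f = Polynomial.C (eval v f) * Polynomial.X ^ n := by
  ext k
  rw [coeff_restrictToLine, Polynomial.coeff_C_mul_X_pow,
    homogeneousComponent_of_mem ((mem_homogeneousSubmodule _ _).2 hf)]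
  split_ifs <;> simp

theorem restrictToLine_eq_zero_iff {K : Type*} [Field K] {s : ℕ} (v : Fin s → K) {n : ℕ}
    {f : MvPolynomial (Fin s) K} (hf : f.IsHomogeneous n) :
    restrictToLine v f = 0 ↔ eval v f = 0 := by
  simp [restrictToLine_of_isHomogeneous v hf]

theorem eval_smul_of_isHomogeneous {K : Type*} [Field K] {s : ℕ} (v : Fin s → K) (a : K) {n : ℕ}
    {f : MvPolynomial (Fin s) K} (hf : f.IsHomogeneous n) :
    eval (a • v) f = eval v f * a ^ n := by
  rw [← eval_restrictToLine, restrictToLine_of_isHomogeneous v hf]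
  simp

theorem vanishesAt_mk_iff {K : Type*} [Field K] {s : ℕ} {n : ℕ} {f : MvPolynomial (Fin s) K}
    (hf : f.IsHomogeneous n) (v : Fin s → K) (hv : v ≠ 0) :
    VanishesAt f (Projectivization.mk K v hv) ↔ eval v f = 0 := by
  refine ⟨fun h => h v hv rfl, fun h w hw hwv => ?_⟩
  obtain ⟨a, rfl⟩ := (Projectivization.mk_eq_mk_iff' K w v hw hv).1 hwv
  rw [eval_smul_of_isHomogeneous v a hf, h, zero_mul]

theorem vanishesAt_iff_eval_rep {K : Type*} [Field K] {s : ℕ} {n : ℕ} {f : MvPolynomial (Fin s) K}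
    (hf : f.IsHomogeneous n) (P : Projectivization K (Fin s → K)) :
    VanishesAt f P ↔ eval P.rep f = 0 := by
  conv_lhs => rw [← P.mk_rep]
  exact vanishesAt_mk_iff hf _ P.rep_nonzero

/-- The coefficients of the restriction are the values of the homogeneous components, so the ideal
is an intersection of kernels of maps to `K[T]`. Vanishing of the restriction as a polynomial
matters: over a finite field, zero values along the line would not suffice. -/
theorem mem_vanishingIdeal_iff {K : Type*} [Field K] {s : ℕ}
    (X : Set (Projectivization K (Fin s → K))) (f : MvPolynomial (Fin s) K) :
    f ∈ vanishingIdeal X ↔ ∀ P ∈ X, restrictToLine P.rep f = 0 := by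
  constructor
  · intro hf P hP
    refine (Ideal.span_le (I := RingHom.ker (restrictToLine P.rep))).2 ?_ hf
    rintro g ⟨⟨n, hn⟩, hg⟩
    exact (restrictToLine_eq_zero_iff _ hn).2 ((vanishesAt_iff_eval_rep hn P).1 (hg P hP))
  · intro h
    rw [← sum_homogeneousComponent f]
    refine Ideal.sum_mem _ fun n _ => Ideal.subset_span
      ⟨⟨n, homogeneousComponent_isHomogeneous n f⟩, fun P hP => ?_⟩
    rw [vanishesAt_iff_eval_rep (homogeneousComponent_isHomogeneous n f), ← coeff_restrictToLine,
      h P hP, Polynomial.coeff_zero]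

theorem mem_vanishingIdeal_iff_of_isHomogeneous {K : Type*} [Field K] {s : ℕ}
    (X : Set (Projectivization K (Fin s → K))) {n : ℕ} {f : MvPolynomial (Fin s) K}
    (hf : f.IsHomogeneous n) :
    f ∈ vanishingIdeal X ↔ ∀ P ∈ X, eval P.rep f = 0 := by
  simp only [mem_vanishingIdeal_iff, restrictToLine_eq_zero_iff _ hf]

theorem restrictToLine_surjective {K : Type*} [Field K] {s : ℕ} {v : Fin s → K} (hv : v ≠ 0) :
    Function.Surjective (restrictToLine v) := by
  obtain ⟨i, hi⟩ := Function.ne_iff.1 hv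
  intro p
  refine ⟨Polynomial.aeval (C (v i)⁻¹ * X i) p, ?_⟩
  rw [← AlgHom.comp_apply]
  have : (restrictToLine v).comp (Polynomial.aeval (C (v i)⁻¹ * X i)) = AlgHom.id K _ := by
    ext1
    have h1 : v i ≠ 0 := hi
    simp [restrictToLine, ← mul_assoc, ← Polynomial.C_mul, h1, MvPolynomial.algHom_C]
  rw [this, AlgHom.id_apply]

/-! ### Dimension, Hilbert function and degree for finite sets of points -/

/-- A nonempty finite set of points has a coordinate ring of Krull dimension one. -/
theorem quotientDim_vanishingIdeal {K : Type*} [Field K] {s : ℕ}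
    {X : Set (Projectivization K (Fin s → K))} (hX : X.Finite) (hX' : X.Nonempty) :
    quotientDim (vanishingIdeal X) = 1 := by
  have hdim : ringKrullDim (Polynomial K) = 1 :=
    IsPrincipalIdealRing.ringKrullDim_eq_one _ (Polynomial.not_isField K)
  set I := vanishingIdeal X with hI
  have hle : ringKrullDim (MvPolynomial (Fin s) K ⧸ I) ≤ 1 := by
    refine Ring.krullDimLE_iff.1 (Ring.krullDimLE_one_iff.2 fun Q hQ => or_iff_not_imp_left.2
      fun hQmin => ?_)
    obtain ⟨Q', hQ', hlt⟩ : ∃ Q' : Ideal (MvPolynomial (Fin s) K ⧸ I), Q'.IsPrime ∧ Q' < Q := by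
      obtain ⟨Q', hQ', hle⟩ := Ideal.exists_minimalPrimes_le (bot_le : ⊥ ≤ Q)
      exact ⟨Q', hQ'.1.1, lt_of_le_of_ne hle fun h => hQmin (h ▸ hQ')⟩
    set φ := Ideal.Quotient.mk I
    have hφ : Function.Surjective φ := Ideal.Quotient.mk_surjective
    have hprime := Ideal.comap_isPrime φ Q'
    -- A prime containing a finite intersection of ideals contains one of them.
    obtain ⟨P, hP, hPQ⟩ : ∃ P ∈ X, RingHom.ker (restrictToLine P.rep) ≤ Q'.comap φ := by
      have := (hprime.inf_le' (s := hX.toFinset)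
        (f := fun P => RingHom.ker (restrictToLine P.rep))).1 ?_
      · simpa using this
      · intro g hg
        have hgI : g ∈ I := (mem_vanishingIdeal_iff X g).2 fun P hP => by
          have := Submodule.mem_finsetInf.1 hg P (by simpa using hP)
          exact this
        rw [Ideal.mem_comap, Ideal.Quotient.eq_zero_iff_mem.2 hgI]
        exact zero_mem _
    have hsurj := restrictToLine_surjective P.rep_nonzero
    have hltc : Q'.comap φ < Q.comap φ := lt_of_le_of_ne
      (Ideal.comap_mono hlt.le) fun h => hlt.ne (Ideal.comap_injective_of_surjective φ hφ h)
    have hQc := Ideal.comap_isPrime φ Q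
    have hmp := Ideal.map_isPrime_of_surjective (f := restrictToLine P.rep) hsurj
      (I := Q.comap φ) (hPQ.trans hltc.le)
    -- The image of `Q` in the principal ideal domain `K[T]` is a nonzero prime, hence maximal.
    have hne : (Q.comap φ).map (restrictToLine P.rep) ≠ ⊥ := by
      intro h
      refine hltc.not_ge (le_trans ?_ hPQ)
      intro g hg
      have := Ideal.mem_map_of_mem (restrictToLine P.rep) hg
      rwa [h, Ideal.mem_bot] at this
    have hmax : ((Q.comap φ).map (restrictToLine P.rep)).IsMaximal := hmp.isMaximal hne
    have hQmax : (Q.comap φ).IsMaximal := by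
      have := Ideal.comap_isMaximal_of_surjective (restrictToLine P.rep) hsurj
        (K := (Q.comap φ).map (restrictToLine P.rep))
      rwa [Ideal.comap_map_of_surjective _ hsurj, sup_eq_left.2] at this
      exact hPQ.trans hltc.le
    rw [← Ideal.map_comap_of_surjective φ hφ Q]
    exact (Ideal.map_eq_top_or_isMaximal_of_surjective φ hφ hQmax).resolve_left fun h => by
      rw [Ideal.map_comap_of_surjective φ hφ Q] at h
      exact hQ.ne_top h
  have hge : 1 ≤ ringKrullDim (MvPolynomial (Fin s) K ⧸ I) := by
    obtain ⟨P, hP⟩ := hX'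
    rw [← hdim]
    refine ringKrullDim_le_of_surjective (Ideal.Quotient.lift I (restrictToLine P.rep).toRingHom
      fun g hg => (mem_vanishingIdeal_iff X g).1 hg P hP) (Ideal.Quotient.lift_surjective_of_surjective _ _
        (restrictToLine_surjective P.rep_nonzero))
  rw [quotientDim, le_antisymm hle hge]
  rfl

/-- A linear form that separates two distinct points. -/
theorem exists_linear_form_separating {K : Type*} [Field K] {s : ℕ}
    {P Q : Projectivization K (Fin s → K)} (h : P ≠ Q) :
    ∃ g : MvPolynomial (Fin s) K, g.IsHomogeneous 1 ∧ eval P.rep g ≠ 0 ∧ eval Q.rep g = 0 := by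
  by_contra! hc
  -- The forms `Q_j t_i - Q_i t_j` vanish at `Q`; if all vanished at `P` too, the two points would
  -- be proportional.
  have hij : ∀ i j, P.rep i * Q.rep j = P.rep j * Q.rep i := fun i j => by
    by_contra hne
    refine hc (C (Q.rep j) * X i - C (Q.rep i) * X j)
      ((isHomogeneous_C_mul_X _ _).sub (isHomogeneous_C_mul_X _ _)) ?_ ?_
    · simp only [map_sub, map_mul, eval_C, eval_X, ne_eq, sub_eq_zero]
      intro h; exact hne (by linear_combination h)
    · simp [mul_comm]
  obtain ⟨j, hj⟩ := Function.ne_iff.1 Q.rep_nonzero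
  rw [Pi.zero_apply] at hj
  refine h ?_
  rw [← P.mk_rep, ← Q.mk_rep, Projectivization.mk_eq_mk_iff']
  refine ⟨P.rep j / Q.rep j, funext fun i => ?_⟩
  rw [Pi.smul_apply, smul_eq_mul]
  field_simp
  linear_combination -hij i j

/-- In large degrees the Hilbert function of a finite set of points is the number of points. -/
theorem hilbertFunction_vanishingIdeal {K : Type*} [Field K] {s : ℕ}
    {X : Set (Projectivization K (Fin s → K))} (hX : X.Finite) {n : ℕ} (hn : X.ncard ≤ n) :
    hilbertFunction (vanishingIdeal X) n = X.ncard := by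
  classical
  have := hX.fintype
  set φ : homogeneousSubmodule (Fin s) K n →ₗ[K] (X → K) :=
    (LinearMap.pi fun P : X => (aeval (R := K) P.1.rep).toLinearMap) ∘ₗ
      (homogeneousSubmodule (Fin s) K n).subtype with hφ
  have hφa : ∀ g P, φ g P = eval P.1.rep g.1 := fun g P => by
    simp [hφ, aeval_eq_eval]
  have hker : (Submodule.restrictScalars K (vanishingIdeal X)).submoduleOf
      (homogeneousSubmodule (Fin s) K n) = LinearMap.ker φ := by
    ext ⟨g, hg⟩
    rw [Submodule.submoduleOf, Submodule.mem_comap, LinearMap.mem_ker, funext_iff]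
    simp only [hφa, Submodule.subtype_apply, Submodule.restrictScalars_mem, Pi.zero_apply,
      Subtype.forall]
    exact mem_vanishingIdeal_iff_of_isHomogeneous X hg
  have hsurj : LinearMap.range φ = ⊤ := by
    rw [eq_top_iff, ← (Pi.basisFun K X).span_eq, Submodule.span_le]
    rintro _ ⟨P, rfl⟩
    have hl : ∀ Q : X, ∃ g : MvPolynomial (Fin s) K,
        g.IsHomogeneous 1 ∧ eval P.1.rep g ≠ 0 ∧ (Q ≠ P → eval Q.1.rep g = 0) := fun Q => by
      by_cases h : Q = P
      · obtain ⟨i, hi⟩ := Function.ne_iff.1 P.1.rep_nonzero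
        exact ⟨MvPolynomial.X i, isHomogeneous_X _ _, by simpa using hi, fun h' => absurd h h'⟩
      · obtain ⟨g, h1, h2, h3⟩ := exists_linear_form_separating
          (fun h' => h (Subtype.ext h'.symm) : P.1 ≠ Q.1)
        exact ⟨g, h1, h2, fun _ => h3⟩
    choose l hl1 hl2 hl3 using hl
    have hcard : (Finset.univ : Finset X).card ≤ n := by
      rwa [Finset.card_univ, ← Nat.card_eq_fintype_card, Nat.card_coe_set_eq]
    -- Up to a scalar, the indicator of `P`: the factor for each `Q ≠ P` kills `Q` but not `P`, and
    -- a power of `l P` pads the degree to `n`.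
    set g : MvPolynomial (Fin s) K := (∏ Q, l Q) * l P ^ (n - (Finset.univ : Finset X).card)
      with hg
    have hgh : g.IsHomogeneous n := by
      have h1 := (IsHomogeneous.prod Finset.univ l (fun _ => 1) fun Q _ => hl1 Q).mul
        ((hl1 P).pow (n - (Finset.univ : Finset X).card))
      rw [Finset.sum_const, smul_eq_mul, mul_one, one_mul, Nat.add_sub_cancel' hcard] at h1
      exact h1
    have hgP : eval P.1.rep g ≠ 0 := by
      rw [hg, map_mul, map_prod, map_pow]
      exact mul_ne_zero (Finset.prod_ne_zero_iff.2 fun Q _ => hl2 Q) (pow_ne_zero _ (hl2 P))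
    refine ⟨(eval P.1.rep g)⁻¹ • ⟨g, hgh⟩, funext fun Q => ?_⟩
    rw [map_smul, Pi.smul_apply, hφa, Pi.basisFun_apply, smul_eq_mul]
    by_cases h : Q = P
    · subst h
      simp [hgP]
    · have hgQ : eval Q.1.rep g = 0 := by
        rw [hg, map_mul, map_prod, Finset.prod_eq_zero (Finset.mem_univ Q) (hl3 Q h), zero_mul]
      rw [Pi.single_eq_of_ne h, hgQ, mul_zero]
  rw [hilbertFunction, hker, (φ.quotKerEquivRange).finrank_eq, hsurj, finrank_top,
    Module.finrank_pi, ← Nat.card_eq_fintype_card, Nat.card_coe_set_eq]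

/-- The degree of the coordinate ring of a finite set of points is the number of points. -/
theorem quotientDegree_vanishingIdeal {K : Type*} [Field K] {s : ℕ}
    {X : Set (Projectivization K (Fin s → K))} (hX : X.Finite) (hX' : X.Nonempty) :
    quotientDegree (vanishingIdeal X) = X.ncard := by
  rw [quotientDegree, quotientDim_vanishingIdeal hX hX', if_neg one_ne_zero]
  simp only [tsub_self, Nat.factorial_zero, Nat.cast_one, pow_zero, div_one, one_mul]
  refine Tendsto.limUnder_eq (tendsto_const_nhds.congr' ?_)
  filter_upwards [eventually_ge_atTop X.ncard] with n hn
  rw [hilbertFunction_vanishingIdeal hX hn]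

/-! ### Degree decompositions -/

theorem IsNested.two_le_card {K : Type*} [Field K] {s : ℕ} {A : Fin s → Finset K}
    (hA : IsNested A) (i : Fin s) : 2 ≤ (A i).card :=
  Finset.one_lt_card.2 ⟨0, hA.zero_mem i, 1, hA.one_mem i, zero_ne_one⟩

theorem setSize_succ {K : Type*} {s : ℕ} (A : Fin s → Finset K) {i : ℕ} (h : i < s) :
    setSize A (i + 1) = (A ⟨i, h⟩).card := by
  simp [setSize, h]

theorem sum_Icc_setSize {K : Type*} {s : ℕ} (A : Fin s → Finset K) (k : ℕ) :
    ∑ i ∈ Finset.Icc 2 (k + 1), (setSize A i - 1)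
      = ∑ i ∈ Finset.range k, (setSize A (i + 2) - 1) := by
  rw [← Finset.Ico_add_one_right_eq_Icc, Finset.sum_Ico_eq_sum_range]
  exact Finset.sum_congr (by congr 1) fun i _ => by rw [add_comm]

theorem existsUnique_isDegreeDecomposition {K : Type*} {s : ℕ} (hs : 2 ≤ s)
    (A : Fin s → Finset K) (d : ℕ) (hd₁ : 1 ≤ d)
    (hd₂ : d ≤ ∑ i ∈ Finset.Icc 2 s, (setSize A i - 1)) :
    ∃! p : ℕ × ℕ, IsDegreeDecomposition A d p.1 p.2 := by
  obtain ⟨n, rfl⟩ : ∃ n, s = n + 1 := ⟨s - 1, by omega⟩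
  rw [sum_Icc_setSize] at hd₂
  set F : ℕ → ℕ := fun k => ∑ i ∈ Finset.range k, (setSize A (i + 2) - 1) with hF
  have hmono : Monotone F := fun a b h => Finset.sum_le_sum_of_subset (by simpa using h)
  have hsucc : ∀ k, F (k + 1) = F k + (setSize A (k + 2) - 1) := fun k =>
    Finset.sum_range_succ _ _
  -- The index `k` is the least one with `d ≤ F (k + 1)`, so that `F k < d ≤ F (k + 1)`.
  have hex : ∃ k, d ≤ F (k + 1) := ⟨n, hd₂.trans (hmono (Nat.le_succ n))⟩
  have hlow : F (Nat.find hex) < d := by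
    rcases hk : Nat.find hex with _ | k
    · simpa [hF] using Nat.lt_of_succ_le hd₁
    · exact not_le.1 (Nat.find_min hex (by omega))
  have hspec := Nat.find_spec hex
  have hn : Nat.find hex < n := by
    by_contra! h
    exact absurd (hd₂.trans (hmono h)) (by omega)
  refine ⟨(Nat.find hex, d - F (Nat.find hex)), ⟨by dsimp only; omega, ?_, ?_, ?_⟩, ?_⟩
  · rw [sum_Icc_setSize]
    exact (Nat.add_sub_cancel' hlow.le).symm
  · dsimp only; omega
  · rw [hsucc] at hspec; dsimp only; omega
  · rintro ⟨k, ℓ⟩ ⟨h1, h2, h3, h4⟩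
    dsimp only at h1 h2 h3 h4
    rw [sum_Icc_setSize] at h2
    change d = F k + ℓ at h2
    have h5 := hsucc k
    have hk : k = Nat.find hex := by
      refine le_antisymm ?_ (Nat.find_min' hex (by omega))
      by_contra! hlt
      exact absurd (hspec.trans (hmono hlt)) (by omega)
    rw [← hk]
    exact Prod.ext rfl (by dsimp only; omega)

/-! ### Standard monomials and the counting bounds -/

/-- The leading monomial of a homogeneous binomial form `t_j - c t_i` with `i < j`. -/
theorem degree_X_sub_C_mul_X {K : Type*} [Field K] {s : ℕ} {i j : Fin s} (hij : i < j) (c : K) :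
    (lexOrder s).degree (X j - C c * X i : MvPolynomial (Fin s) K) = Finsupp.single j 1 := by
  classical
  rw [sub_eq_add_neg, MonomialOrder.degree_add_of_lt, MonomialOrder.degree_X]
  rw [MonomialOrder.degree_X, ← neg_mul, ← C_neg, C_mul_X_eq_monomial]
  refine lt_of_le_of_lt (MonomialOrder.degree_monomial_le _) ?_
  rw [lexOrder_lt_iff]
  refine ⟨j, fun l hl => ?_, ?_⟩
  · rw [Finsupp.single_eq_of_ne (by omega), Finsupp.single_eq_of_ne (by omega)]
  · rw [Finsupp.single_eq_of_ne (by omega), Finsupp.single_eq_same]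
    exact one_pos

/-- The form `t_i ∏_{c ∈ A_j} (t_j - c t_i)`, for `i < j`, vanishes on the nested cartesian set. -/
theorem X_mul_prod_mem_vanishingIdeal {K : Type*} [Field K] {s : ℕ} {A : Fin s → Finset K}
    (hA : IsNested A) {i j : Fin s} (hij : i < j) :
    (X i * ∏ c ∈ A j, (X j - C c * X i) : MvPolynomial (Fin s) K)
      ∈ vanishingIdeal (cartesianSet A) := by
  have hhom : (X i * ∏ c ∈ A j, (X j - C c * X i) : MvPolynomial (Fin s) K).IsHomogeneous
      (1 + ∑ _c ∈ A j, 1) :=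
    (isHomogeneous_X _ _).mul (IsHomogeneous.prod _ _ _ fun c _ =>
      (isHomogeneous_X _ _).sub (isHomogeneous_C_mul_X _ _))
  refine Ideal.subset_span ⟨⟨_, hhom⟩, ?_⟩
  rintro _ ⟨v, hv, hvA, rfl⟩
  rw [vanishesAt_mk_iff hhom, map_mul, map_prod, eval_X]
  by_cases h : v i = 0
  · rw [h, zero_mul]
  · rw [Finset.prod_eq_zero (hA.div_mem i j hij _ (hvA j) _ (hvA i) h), mul_zero]
    simp [h]

/-- A standard monomial divisible by `t_i` has degree less than `d_j` in `t_j` for `j > i`. -/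
theorem IsStandardMonomial.lt_card {K : Type*} [Field K] {s : ℕ} {A : Fin s → Finset K}
    (hA : IsNested A) {a : Fin s →₀ ℕ}
    (ha : IsStandardMonomial (lexOrder s) (vanishingIdeal (cartesianSet A)) a)
    {i j : Fin s} (hij : i < j) (hi : a i ≠ 0) : a j < (A j).card := by
  classical
  by_contra! hj
  have hne : ∀ c ∈ A j, (X j - C c * X i : MvPolynomial (Fin s) K) ≠ 0 := fun c _ =>
    MonomialOrder.ne_zero_of_degree_ne_zero (m := lexOrder s) (by
      rw [degree_X_sub_C_mul_X hij]; simp)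
  have hprod : (∏ c ∈ A j, (X j - C c * X i : MvPolynomial (Fin s) K)) ≠ 0 :=
    Finset.prod_ne_zero_iff.2 hne
  have hXprod : (X i * ∏ c ∈ A j, (X j - C c * X i) : MvPolynomial (Fin s) K) ≠ 0 :=
    mul_ne_zero (X_ne_zero i) hprod
  have hle : Finsupp.single i 1 + Finsupp.single j (A j).card ≤ a := fun l => by
    rw [Finsupp.add_apply, Finsupp.single_apply, Finsupp.single_apply]
    split_ifs with h1 h2 h2
    · omega
    · subst h1; omega
    · subst h2; omega
    · omega
  have hmon : (monomial (a - (Finsupp.single i 1 + Finsupp.single j (A j).card)) 1 :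
      MvPolynomial (Fin s) K) ≠ 0 := by simp
  refine ha _ (Ideal.mul_mem_left _ (monomial (a - (Finsupp.single i 1 +
    Finsupp.single j (A j).card)) 1) (X_mul_prod_mem_vanishingIdeal hA hij))
    (mul_ne_zero hmon hXprod) ?_
  rw [MonomialOrder.degree_mul hmon hXprod, MonomialOrder.degree_mul (X_ne_zero i) hprod,
    MonomialOrder.degree_prod hne, MonomialOrder.degree_X, MonomialOrder.degree_monomial,
    if_neg one_ne_zero, Finset.sum_congr rfl fun c _ => degree_X_sub_C_mul_X hij c,
    Finset.sum_const, Finsupp.smul_single, smul_eq_mul, mul_one]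
  exact tsub_add_cancel_of_le hle

/-- The footprint bound for homogeneous polynomials and the points with nonzero first coordinate:
if `t^a` is the leading monomial of `f`, then `f` has at least `∏_{j ≥ 2} (d_j - a_j)` nonzeros. -/
theorem prod_le_ncard_diff_zeroSet {K : Type*} [Field K] [Finite K] {n : ℕ}
    {A : Fin (n + 1) → Finset K} (hA : IsNested A) {d : ℕ} {f : MvPolynomial (Fin (n + 1)) K}
    (hfd : f.IsHomogeneous d) (hf : f ≠ 0) :
    ∏ i : Fin n, ((A i.succ).card - (lexOrder (n + 1)).degree f i.succ) ≤
      (cartesianSet A \ zeroSet (cartesianSet A) f).ncard := by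
  classical
  set a := (lexOrder (n + 1)).degree f with ha
  have hamem : a ∈ f.support := MonomialOrder.degree_mem_support hf
  have hev : ∀ v : Fin n → K, eval (Fin.cons 1 v : Fin (n + 1) → K) f
      = ∑ t ∈ f.support, coeff t f * ∏ i, v i ^ t (Fin.succ i) := fun v => by
    rw [eval_eq']
    exact Finset.sum_congr rfl fun t _ => by simp [Fin.prod_univ_succ]
  have key := lex_footprint n (fun i => A i.succ) f.support (fun t => coeff t f)
    (fun t i => t i.succ) a hamem (mem_support_iff.1 hamem) fun t ht hta => by
      obtain ⟨j, hj, hj'⟩ := (lexOrder_lt_iff t a).1 (lt_of_le_of_ne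
        (MonomialOrder.le_degree ht) fun h => hta ((lexOrder (n + 1)).toSyn.injective h))
      induction j using Fin.cases with
      -- If two exponents differed only at `t_1`, homogeneity would make them equal; hence setting
      -- `t_1 = 1` keeps the strict order.
      | zero =>
        have h1 := hfd.degree_eq_sum_deg_support ht
        have h2 := hfd.degree_eq_sum_deg_support hamem
        rw [← Finsupp.degree_apply, Finsupp.degree_eq_sum, Fin.sum_univ_succ] at h1 h2
        rw [Finset.sum_congr rfl fun i _ => hj (Fin.succ i) (Fin.succ_pos i)] at h1
        omega
      | succ j => exact ⟨j, fun i hi => hj _ (by simpa using hi), hj'⟩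
  simp only [← hev] at key
  refine key.trans ?_
  have hcons : ∀ v : Fin n → K, (Fin.cons 1 v : Fin (n + 1) → K) ≠ 0 := fun v h =>
    one_ne_zero (congrFun h 0)
  have hfin : Finite (Projectivization K (Fin (n + 1) → K)) := Quotient.finite _
  rw [← Set.ncard_coe_finset]
  refine Set.ncard_le_ncard_of_injOn
    (fun v : Fin n → K => Projectivization.mk K (Fin.cons 1 v : Fin (n + 1) → K) (hcons v))
    ?_ ?_ (Set.toFinite _)
  · intro v hv
    rw [Finset.mem_coe, Finset.mem_filter, Fintype.mem_piFinset] at hv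
    refine ⟨⟨_, hcons v, fun i => ?_, rfl⟩, fun h => hv.2 ((vanishesAt_mk_iff hfd _ _).1 h.2)⟩
    induction i using Fin.cases with
    | zero => simpa using hA.one_mem 0
    | succ i => simpa using hv.1 i
  · intro v _ w _ h
    obtain ⟨c, hc⟩ := (Projectivization.mk_eq_mk_iff' K _ _ _ _).1 h
    have hc1 : c = 1 := by simpa using congrFun hc 0
    rw [hc1, one_smul] at hc
    exact (Fin.cons_injective2 hc).2.symm

theorem cartesianSet_nonempty {K : Type*} [Field K] {s : ℕ} (hs : 0 < s) {A : Fin s → Finset K}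
    (hA : IsNested A) : (cartesianSet A).Nonempty :=
  ⟨_, fun _ => 1, fun h => one_ne_zero (congrFun h ⟨0, hs⟩), hA.one_mem, rfl⟩

/-- A product of `d_j - a_j`, `j ≥ 2`, is bounded below through a degree decomposition of a strict
upper bound of the sum of the `a_j`. -/
theorem le_prod_card_sub {K : Type*} [Field K] {n : ℕ} {A : Fin (n + 1) → Finset K}
    (hA : IsNested A) {d k ℓ : ℕ} (h : IsDegreeDecomposition A d k ℓ) (a : Fin n → ℕ)
    (ha : ∀ i, a i < (A i.succ).card) (had : ∑ i, a i < d) :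
    (setSize A (k + 2) - ℓ + 1) * ∏ i ∈ Finset.Icc (k + 3) (n + 1), setSize A i
      ≤ ∏ i : Fin n, ((A i.succ).card - a i) := by
  obtain ⟨hk, hd, hℓ, hℓ'⟩ := h
  rw [sum_Icc_setSize] at hd
  have hsize : ∀ i : Fin n, setSize A (i + 2) = (A i.succ).card := fun i =>
    setSize_succ A (by omega)
  have hcard : ∀ i : Fin n, 2 ≤ setSize A (i + 2) := fun i => hsize i ▸ hA.two_le_card _
  set E : ℕ → ℕ := fun i => setSize A (i + 2) - 1 with hE
  set x : ℕ → ℕ := fun i => if h : i < n then E i - a ⟨i, h⟩ else 0 with hx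
  have hxi : ∀ i : Fin n, x i = E i - a i := fun i => by simp [hx]
  have haE : ∀ i : Fin n, a i ≤ E i := fun i => by
    have := ha i
    rw [← hsize] at this
    exact Nat.le_sub_one_of_lt this
  have hsum : ∑ i ∈ Finset.range n, x i + ∑ i, a i = ∑ i ∈ Finset.range n, E i := by
    rw [Finset.sum_range, Finset.sum_range, ← Finset.sum_add_distrib]
    exact Finset.sum_congr rfl fun i _ => by rw [hxi, Nat.sub_add_cancel (haE i)]
  have hsplit : ∑ i ∈ Finset.range n, E i
      = ∑ i ∈ Finset.range k, E i + E k + ∑ i ∈ Finset.Ico (k + 1) n, E i := by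
    rw [← Finset.sum_range_succ, Finset.sum_range_add_sum_Ico _ (by omega)]
  have hEv : ∀ i, E i = setSize A (i + 2) - 1 := fun _ => rfl
  have hEk := hEv k
  have hkc : 2 ≤ setSize A (k + 2) := hcard ⟨k, by omega⟩
  change d = ∑ i ∈ Finset.range k, E i + ℓ at hd
  -- Here `setSize A (k + 2) - ℓ` is `E k - ℓ + 1`: the extra unit comes from the strict inequality
  -- `had`, and `1 ≤ ℓ` keeps it at most `E k`.
  have := prod_one_add_ge E n (fun i j hij hj => by
      have := hA.card_mono (Fin.succ ⟨i, by omega⟩) (Fin.succ ⟨j, hj⟩) (by simpa using hij)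
      rw [← hsize, ← hsize] at this
      exact Nat.sub_le_sub_right this 1)
    k (setSize A (k + 2) - ℓ) (by omega) (by omega) x
    (fun i hi => by rw [hxi ⟨i, hi⟩]; exact Nat.sub_le _ _) (by omega)
  refine le_trans (le_of_eq ?_) (this.trans (le_of_eq ?_))
  · rw [add_comm 1]
    congr 1
    rw [← Finset.Ico_add_one_right_eq_Icc, Finset.prod_Ico_eq_prod_range,
      Finset.prod_Ico_eq_prod_range]
    refine Finset.prod_congr (by congr 1; omega) fun i hi => ?_
    rw [Finset.mem_range] at hi
    have h2 := hcard ⟨k + 1 + i, by omega⟩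
    have h3 : k + 3 + i = k + 1 + i + 2 := by ring
    rw [h3]
    rw [hEv]
    dsimp only at h2
    omega
  · rw [Finset.prod_range]
    refine Finset.prod_congr rfl fun i _ => ?_
    rw [hxi, ← hsize]
    have h1 := haE i
    have h2 := hcard i
    rw [hEv] at h1 ⊢
    omega

end NestedCartesian

theorem theorem5p5 {K : Type*} [Field K] [Finite K] {s : ℕ} (hs : 2 ≤ s)
    (A : Fin s → Finset K) (hA : NestedCartesian.IsNested A) (d : ℕ) (hd₁ : 1 ≤ d)
    (hd₂ : d ≤ ∑ i ∈ Finset.Icc 2 s, (NestedCartesian.setSize A i - 1))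
    (f : MvPolynomial (Fin s) K) (hfd : f.IsHomogeneous d)
    (hf : NestedCartesian.IsStandardPolynomial (NestedCartesian.lexOrder s)
      (NestedCartesian.vanishingIdeal (NestedCartesian.cartesianSet A)) f)
    (hft : (MvPolynomial.X ⟨0, by omega⟩ : MvPolynomial (Fin s) K) ∣
      NestedCartesian.initialMonomial (NestedCartesian.lexOrder s) f) :
    (∃! p : ℕ × ℕ, NestedCartesian.IsDegreeDecomposition A d p.1 p.2) ∧
    ∀ k ℓ : ℕ, NestedCartesian.IsDegreeDecomposition A d k ℓ →
      ((NestedCartesian.zeroSet (NestedCartesian.cartesianSet A) f).ncard : ℝ) ≤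
        NestedCartesian.quotientDegree
            (NestedCartesian.vanishingIdeal (NestedCartesian.cartesianSet A)) -
          ((NestedCartesian.setSize A (k + 2) : ℝ) - ℓ + 1) *
            ∏ i ∈ Finset.Icc (k + 3) s, (NestedCartesian.setSize A i : ℝ) := by
  open NestedCartesian in
  refine ⟨existsUnique_isDegreeDecomposition hs A d hd₁ hd₂, fun k ℓ h => ?_⟩
  obtain ⟨n, rfl⟩ : ∃ n, s = n + 1 := ⟨s - 1, by omega⟩
  have hfin : Finite (Projectivization K (Fin (n + 1) → K)) := Quotient.finite _
  set a := (lexOrder (n + 1)).degree f with ha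
  have hamem : a ∈ f.support := MonomialOrder.degree_mem_support hf.1
  have ha0 : a 0 ≠ 0 := by
    rcases MvPolynomial.X_dvd_monomial.1 hft with h | h
    · exact absurd h one_ne_zero
    · exact h
  have hcard : ∀ i : Fin n, a i.succ < (A i.succ).card := fun i =>
    (hf.2 a hamem).lt_card hA (Fin.succ_pos i) ha0
  -- The factor `t_1` uses up at least one unit of the degree; this is the source of the `+ 1` in
  -- the bound.
  have hsum : ∑ i : Fin n, a i.succ < d := by
    have h1 := hfd.degree_eq_sum_deg_support hamem
    rw [← Finsupp.degree_apply, Finsupp.degree_eq_sum, Fin.sum_univ_succ] at h1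
    omega
  have hle := (le_prod_card_sub hA h (fun i => a i.succ) hcard hsum).trans
    (prod_le_ncard_diff_zeroSet hA hfd hf.1)
  have hsub : zeroSet (cartesianSet A) f ⊆ cartesianSet A := fun P hP => hP.1
  have hdiff := Set.ncard_sdiff_add_ncard_of_subset hsub (Set.toFinite _)
  rw [quotientDegree_vanishingIdeal (Set.toFinite _) (cartesianSet_nonempty (by omega) hA),
    ← hdiff]
  have hℓ : ℓ ≤ setSize A (k + 2) := h.2.2.2.trans (Nat.sub_le _ _)
  have hle' : ((setSize A (k + 2) : ℝ) - ℓ + 1) *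
      ∏ i ∈ Finset.Icc (k + 3) (n + 1), (setSize A i : ℝ) ≤
      ((cartesianSet A \ zeroSet (cartesianSet A) f).ncard : ℝ) := by
    have := (Nat.cast_le (α := ℝ)).2 hle
    push_cast [Nat.cast_sub hℓ] at this
    exact this
  push_cast
  linarith
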